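/- **Theorem (Iteration complexity of Smoothed GDA).** Consider $\min_{x\in\mathcal X}\max_{y\in\mathcal Y} f(x,y)$, where $\mathcal X\subseteq\mathbb R^n$ is closed and convex, $\mathcal Y\subseteq\mathbb R^d$ is compact and convex with diameter $D_{\mathcal Y}>0$, $f:\mathbb R^n\times\mathbb R^d\to\mathbb R$ is continuously differentiable, $f(x,\cdot)$ is concave on $\mathcal Y$ for every $x\in\mathcal X$, and for some $\ell>0$, for all $x,x'\in\mathcal X$ and $y,y'\in\mathcal Y$, both $\|\nabla_xf(x,y)-\nabla_xf(x',y')\|$ and $\|\nabla_yf(x,y)-\nabla_yf(x',y')\|$ are at most $\ell(\|x-x'\|+\|y-y'\|)$. Let $\Phi(x)=\max_{y\in\mathcal Y}f(x,y)$ be bounded below on $\mathcal X$. Write $F(x,y,z)=f(x,y)+\frac{r_x}{2}\|x-z\|^2$. *Smoothed GDA*, started at $(x_0,y_0,z_0)\in\mathcal X\times\mathcal Y\times\mathbb R^n$, is the iteration $$x_{t+1}=\mathrm{proj}_{\mathcal X}(x_t-c\nabla_xF(x_t,y_t,z_t)),\quad y_{t+1}=\mathrm{proj}_{\mathcal Y}(y_t+\alpha\nabla_yF(x_{t+1},y_t,z_t)),\quad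 z_{t+1}=z_t+\beta(x_{t+1}-z_t).$$ Put $\Psi_2(x,y,z)=F(x,y,z)-2\inf_{x'\in\mathcal X}F(x',y,z)+2\inf_{x'\in\mathcal X}\max_{y'\in\mathcal Y}F(x',y',z)$ and $\Delta_{\Psi_2}=\Psi_2(x_0,y_0,z_0)-\inf_{x\in\mathcal X}\Phi(x)$. Let $\epsilon>0$. A point $x\in\mathcal X$ is an *$\epsilon$-OS* if $\Phi+\ell\|\cdot-x\|^2$ has a unique minimizer $p$ over $\mathcal X$ (so $p=\mathrm{prox}_{\Phi/(2\ell)}(x)$) and $\|p-x\|\le\frac{\epsilon}{2\ell}$. A pair $(x,y)\in\mathcal X\times\mathcal Y$ is an *$\epsilon$-GS* if $\mathrm{dist}(0,\nabla_xf(x,y)+\partial\iota_{\mathcal X}(x))\le\epsilon$ and $\mathrm{dist}(0,-\nabla_yf(x,y)+\partial\iota_{\mathcal Y}(y))\le\epsilon$, where $\iota$ denotes the indicator function of a convex set. For all constants $\kappa,\gamma,a>0$ there is a constant $b_0>0$ such that for every $b_1>0$ there is a constant $C>0$ (so $b_0$ depends only on $\kappa,\gamma,a$ and $C$ only on $\kappa,\gamma,a,b_1$)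 with the following property, for all dimensions, problems and starting points as above and all $\epsilon>0$. Suppose the parameters satisfy * $3\ell<r_x\le\kappa\ell$ (that is, $r_x=\Theta(\ell)$); * $\frac{\gamma}{\ell}\le c<\frac1{r_x+\ell}$ (that is, $c=\Theta(1/\ell)$); * $\frac a\ell\le\alpha\le\min\bigl\{\frac1{11\ell},\frac{c^2(r_x-\ell)^2}{4\ell(1+c(r_x-\ell))^2}\bigr\}$ (that is, $\alpha=\Theta(1/\ell)$); * $0<\beta\le\min\bigl\{\frac1{36},\frac{(r_x-\ell)^2}{384\,r_x(r_x+\ell)^2}\bigr\}$ and $b_1\frac{\epsilon^2}{\ell^2D_{\mathcal Y}^2}\le\beta\le b_0\frac{\epsilon^2}{\ell^2D_{\mathcal Y}^2}$ (that is, $\beta=\Theta(\epsilon^2/(\ell^2D_{\mathcal Y}^2))$ with a sufficiently small constant). Then there is an index $t\ge0$ with $$t\le C\,\frac{\ell^3D_{\mathcal Y}^2\Delta_{\Psi_2}}{\epsilon^4}$$ such that $(x_{t+1},y_{t+1})$ is an $\epsilon$-GS and $x_{t+1}$ is an $\epsilon$-OS of the problem. -/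

import Mathlib

namespace MinimaxNCC

/-- Euclidean space of dimension `n`. -/
abbrev E (n : ℕ) : Type := EuclideanSpace ℝ (Fin n)

/-- `f` is continuously differentiable and its partial gradients are `ℓ`-Lipschitz on `X × Y`. -/
structure IsSmoothOn {n d : ℕ} (f : E n → E d → ℝ) (X : Set (E n)) (Y : Set (E d)) (ℓ : ℝ) :
    Prop where
  pos : 0 < ℓ
  contDiff : ContDiff ℝ 1 (fun q : E n × E d => f q.1 q.2)
  lipschitz_x : ∀ x ∈ X, ∀ x' ∈ X, ∀ y ∈ Y, ∀ y' ∈ Y,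
    ‖gradient (fun u => f u y) x - gradient (fun u => f u y') x'‖ ≤ ℓ * (‖x - x'‖ + ‖y - y'‖)
  lipschitz_y : ∀ x ∈ X, ∀ x' ∈ X, ∀ y ∈ Y, ∀ y' ∈ Y,
    ‖gradient (fun v => f x v) y - gradient (fun v => f x' v) y'‖ ≤ ℓ * (‖x - x'‖ + ‖y - y'‖)

/-- The value function `Φ(x) = max_{y ∈ Y} f(x, y)` (finite part; the constraint `x ∈ X` is imposed
separately wherever `Φ` is minimized). -/
noncomputable def valueFn {n d : ℕ} (f : E n → E d → ℝ) (Y : Set (E d)) (x : E n) : ℝ :=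
  sSup ((fun y => f x y) '' Y)

/-- The set of minimizers over `X` of `u ↦ φ(u) + (1/(2s)) ‖u - x‖²`;
`prox_{s φ}(x)` is its unique element. -/
def proxSet {n : ℕ} (X : Set (E n)) (φ : E n → ℝ) (s : ℝ) (x : E n) : Set (E n) :=
  {u | u ∈ X ∧ ∀ w ∈ X,
    φ u + 1 / (2 * s) * ‖u - x‖ ^ 2 ≤ φ w + 1 / (2 * s) * ‖w - x‖ ^ 2}

/-- `x` is an `ε`-optimization-stationary point: `x ∈ X`, the proximal point
`prox_{Φ/(2ℓ)}(x)` is well defined, and its distance to `x` is at most `ε/(2ℓ)`. -/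
def IsOS {n d : ℕ} (f : E n → E d → ℝ) (X : Set (E n)) (Y : Set (E d)) (ℓ ε : ℝ)
    (x : E n) : Prop :=
  x ∈ X ∧ ∃ p : E n, proxSet X (valueFn f Y) (1 / (2 * ℓ)) x = {p} ∧ ‖p - x‖ ≤ ε / (2 * ℓ)

/-- The normal cone of `S` at `x`, i.e. the subdifferential at `x ∈ S` of the indicator
function of the convex set `S`. -/
def normalCone {n : ℕ} (S : Set (E n)) (x : E n) : Set (E n) :=
  {v | ∀ u ∈ S, inner ℝ v (u - x) ≤ 0}

/-- `(x, y)` is an `ε`-game-stationary point: `(x, y) ∈ X × Y`,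
`dist(0, ∇ₓ f(x,y) + ∂ι_X(x)) ≤ ε` and `dist(0, -∇_y f(x,y) + ∂ι_Y(y)) ≤ ε`. -/
def IsGS {n d : ℕ} (f : E n → E d → ℝ) (X : Set (E n)) (Y : Set (E d)) (ε : ℝ)
    (x : E n) (y : E d) : Prop :=
  x ∈ X ∧ y ∈ Y ∧
    Metric.infDist 0 ((fun v => gradient (fun u => f u y) x + v) '' normalCone X x) ≤ ε ∧
    Metric.infDist 0 ((fun v => -gradient (fun w => f x w) y + v) '' normalCone Y y) ≤ ε

/-- `v` is a Euclidean projection of `u` onto `S` (the projection, for `S` closed and convex). -/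
def IsProj {n : ℕ} (S : Set (E n)) (u v : E n) : Prop :=
  v ∈ S ∧ ∀ w ∈ S, ‖u - v‖ ≤ ‖u - w‖

/-- The smoothed surrogate `F(x, y, z) = f(x, y) + (r/2) ‖x - z‖²`. -/
noncomputable def surrogate {n d : ℕ} (f : E n → E d → ℝ) (r : ℝ) (x : E n) (y : E d)
    (z : E n) : ℝ :=
  f x y + r / 2 * ‖x - z‖ ^ 2

/-- The sequence `(x t, y t, z t)` is generated by Smoothed GDA with parameters `r, c, α, β`
from an initial point in `X × Y × ℝⁿ`. -/
structure IsSmoothedGDA {n d : ℕ} (f : E n → E d → ℝ) (X : Set (E n)) (Y : Set (E d))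
    (r c α β : ℝ) (x : ℕ → E n) (y : ℕ → E d) (z : ℕ → E n) : Prop where
  init_x : x 0 ∈ X
  init_y : y 0 ∈ Y
  step_x : ∀ t, IsProj X
    (x t - c • gradient (fun u => surrogate f r u (y t) (z t)) (x t)) (x (t + 1))
  step_y : ∀ t, IsProj Y
    (y t + α • gradient (fun v => surrogate f r (x (t + 1)) v (z t)) (y t)) (y (t + 1))
  step_z : ∀ t, z (t + 1) = z t + β • (x (t + 1) - z t)

/-- `d(y, z) = min_{x ∈ X} F(x, y, z)`. -/
noncomputable def dualFn {n d : ℕ} (f : E n → E d → ℝ) (X : Set (E n)) (r : ℝ) (y : E d)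
    (z : E n) : ℝ :=
  sInf ((fun x => surrogate f r x y z) '' X)

/-- `p(z) = min_{x ∈ X} max_{y ∈ Y} F(x, y, z)`. -/
noncomputable def proxFn {n d : ℕ} (f : E n → E d → ℝ) (X : Set (E n)) (Y : Set (E d)) (r : ℝ)
    (z : E n) : ℝ :=
  sInf ((fun x => sSup ((fun y => surrogate f r x y z) '' Y)) '' X)

/-- The potential `Ψ₂(x, y, z) = F(x, y, z) - 2 d(y, z) + 2 p(z)`. -/
noncomputable def potential {n d : ℕ} (f : E n → E d → ℝ) (X : Set (E n)) (Y : Set (E d))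
    (r : ℝ) (x : E n) (y : E d) (z : E n) : ℝ :=
  surrogate f r x y z - 2 * dualFn f X r y z + 2 * proxFn f X Y r z

/-- The initial gap `Δ = Ψ₂(x₀, y₀, z₀) - min_{x ∈ X} max_{y ∈ Y} f(x, y)`. -/
noncomputable def initialGap {n d : ℕ} (f : E n → E d → ℝ) (X : Set (E n)) (Y : Set (E d))
    (r : ℝ) (x₀ : E n) (y₀ : E d) (z₀ : E n) : ℝ :=
  potential f X Y r x₀ y₀ z₀ - sInf (valueFn f Y '' X)

/-- The step-size conditions common to all accuracies. The numbers `κ, γ, a` are the constants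
hidden in `r = Θ(ℓ)`, `c = Θ(1/ℓ)`, `α = Θ(1/ℓ)`; the opposite bounds of these three relations
follow from the explicit inequalities. -/
structure StepSizes (κ γ a ℓ r c α β : ℝ) : Prop where
  r_lower : 3 * ℓ < r
  r_upper : r ≤ κ * ℓ
  c_lower : γ / ℓ ≤ c
  c_upper : c < 1 / (r + ℓ)
  α_lower : a / ℓ ≤ α
  α_upper : α ≤ min (1 / (11 * ℓ)) (c ^ 2 * (r - ℓ) ^ 2 / (4 * ℓ * (1 + c * (r - ℓ)) ^ 2))
  β_pos : 0 < β
  β_upper : β ≤ min (1 / 36) ((r - ℓ) ^ 2 / (384 * r * (r + ℓ) ^ 2))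

end MinimaxNCC

namespace MinimaxNCC

open Set Filter Topology
open scoped RealInnerProductSpace

/-!
The potential `Ψ₂ = F - 2 d + 2 p` never drops below `inf Φ`. Strong convexity of `F(·, y, z)` makes
its minimizer Lipschitz in `(y, z)`, and the gap between that minimizer and the minimizer of
`max_y F(·, y, z)` is controlled only to first order, through the diameter `D` of `Y` (dual error
bound): with `δ = ‖x - x'‖`, `η = ‖y' - y‖`, `w = ‖x' - z‖` one iteration gives
`Ψ₂' + ℓ/2 δ² + ℓ/2 η² + ℓ β w² ≤ Ψ₂ + 9 K² ℓ β² D²`. For `ρ = ε / (4 K ℓ)` and `β ≲ ρ² / D²`, the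
noise is dominated by `ℓ β ρ² / 4`, so an iteration that fails to decrease `Ψ₂` by this amount has
`δ, η ≤ √β ρ` and `w ≤ ρ`, which forces stationarity with dual gap `≲ D η ≲ ρ²`. There are at most
`4 Δ / (ℓ β ρ²)` iterations of the other kind.
-/

section StronglyConvex

variable {V : Type*} [NormedAddCommGroup V]

theorem add_add_sq_norm_sub_le_of_tendsto_slope [NormedSpace ℝ V] {s : Set V} {g : V → ℝ}
    {μ d₀ : ℝ} (hg : StrongConvexOn s μ g) {u v : V} (hu : u ∈ s) (hv : v ∈ s) {d : ℝ → ℝ}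
    (hd : Tendsto d (𝓝[>] 0) (𝓝 d₀))
    (hle : ∀ t ∈ Ioo (0 : ℝ) 1, d t ≤ t⁻¹ * (g (u + t • (v - u)) - g u)) :
    g u + d₀ + μ / 2 * ‖v - u‖ ^ 2 ≤ g v := by
  have hlim : Tendsto (fun t : ℝ => g v - g u - (1 - t) * (μ / 2 * ‖v - u‖ ^ 2)) (𝓝[>] 0)
      (𝓝 (g v - g u - (1 - 0) * (μ / 2 * ‖v - u‖ ^ 2))) :=
    (Continuous.tendsto (by fun_prop) 0).mono_left nhdsWithin_le_nhds
  have hslope : ∀ t ∈ Ioo (0 : ℝ) 1, d t ≤ g v - g u - (1 - t) * (μ / 2 * ‖v - u‖ ^ 2) := by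
    intro t ht
    have hconv := hg.2 hu hv (sub_nonneg.2 ht.2.le) ht.1.le (sub_add_cancel 1 t)
    have hpoint : (1 - t) • u + t • v = u + t • (v - u) := by module
    rw [hpoint, norm_sub_rev u v, smul_eq_mul, smul_eq_mul] at hconv
    refine (hle t ht).trans ((inv_mul_le_iff₀ ht.1).2 ?_)
    linarith
  have := le_of_tendsto_of_tendsto hd hlim
    (Filter.mem_of_superset (Ioo_mem_nhdsGT one_pos) hslope)
  linarith

theorem add_sq_norm_sub_le_of_isMinOn [NormedSpace ℝ V] {s : Set V} {g : V → ℝ} {μ : ℝ}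
    (hg : StrongConvexOn s μ g) {p v : V} (hp : p ∈ s) (hmin : IsMinOn g s p) (hv : v ∈ s) :
    g p + μ / 2 * ‖v - p‖ ^ 2 ≤ g v := by
  simpa only [add_zero] using
    add_add_sq_norm_sub_le_of_tendsto_slope hg hp hv tendsto_const_nhds fun t ht =>
      mul_nonneg (inv_nonneg.2 ht.1.le)
        (sub_nonneg.2 (hmin (hg.1.add_smul_sub_mem hp hv (Ioo_subset_Icc_self ht))))

theorem exists_isMinOn_of_strongConvexOn [NormedSpace ℝ V] [ProperSpace V] {s : Set V} {g : V → ℝ}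
    {μ : ℝ} (hμ : 0 < μ) (hg : StrongConvexOn s μ g) (hcont : ContinuousOn g s) (hs : IsClosed s)
    (hne : s.Nonempty) : ∃ p ∈ s, IsMinOn g s p := by
  obtain ⟨u, hu⟩ := hne
  have hball : u ∈ s ∩ Metric.closedBall u 1 := ⟨hu, Metric.mem_closedBall_self zero_le_one⟩
  obtain ⟨q, -, hq⟩ := ((isCompact_closedBall u 1).inter_left hs).exists_isMinOn ⟨u, hball⟩
    (hcont.mono inter_subset_left)
  refine hcont.exists_isMinOn' hs hu ?_
  filter_upwards [mem_inf_of_left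
      (isCompact_closedBall u (1 + 2 * (g u - g q) / μ)).compl_mem_cocompact,
    mem_inf_of_right (mem_principal_self s)] with v hfar hv
  have hfar' : 1 + 2 * (g u - g q) / μ < ‖v - u‖ := by
    simpa only [mem_compl_iff, mem_closedBall_iff_norm, not_le] using hfar
  set ρ := ‖v - u‖ with hρ_def
  have hsteep : g u - g q ≤ (ρ - 1) * (μ / 2) := by
    rw [← lt_sub_iff_add_lt', div_lt_iff₀ hμ] at hfar'
    linarith
  have hρ : 1 ≤ ρ := by
    have : g q ≤ g u := hq hball
    exact le_of_mul_le_mul_right (a := μ / 2) (by linarith) (half_pos hμ)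
  have hρ0 : 0 < ρ := one_pos.trans_le hρ
  -- Strong convexity on the segment from `u` to `v`, at its point on the unit sphere around `u`.
  have hw := hg.2 hu hv (sub_nonneg.2 (inv_le_one_of_one_le₀ hρ)) (by positivity)
    (sub_add_cancel 1 ρ⁻¹)
  have hqw : g q ≤ g ((1 - ρ⁻¹) • u + ρ⁻¹ • v) := by
    refine hq ⟨hg.1 hu hv (sub_nonneg.2 (inv_le_one_of_one_le₀ hρ)) (by positivity) (by ring), ?_⟩
    have hwu : (1 - ρ⁻¹) • u + ρ⁻¹ • v - u = ρ⁻¹ • (v - u) := by module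
    rw [mem_closedBall_iff_norm, hwu, norm_smul, Real.norm_of_nonneg (by positivity)]
    exact (inv_mul_cancel₀ hρ0.ne').le
  rw [norm_sub_rev u v, ← hρ_def, smul_eq_mul, smul_eq_mul] at hw
  have hscaled : ρ * g q ≤ (ρ - 1) * g u + g v - ρ * ((ρ - 1) * (μ / 2)) := by
    refine (mul_le_mul_of_nonneg_left (hqw.trans hw) hρ0.le).trans_eq ?_
    field_simp
  linarith [mul_le_mul_of_nonneg_left hsteep hρ0.le]

theorem strongConvexOn_sq_norm_sub [InnerProductSpace ℝ V] {s : Set V} (hs : Convex ℝ s) (m : ℝ)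
    (z : V) : StrongConvexOn s m fun x => m / 2 * ‖x - z‖ ^ 2 := by
  refine ⟨hs, fun x _ y _ a b ha hb hab => le_of_eq ?_⟩
  obtain rfl : a = 1 - b := eq_sub_of_add_eq hab
  have hpoint : (1 - b) • x + b • y - z = (1 - b) • (x - z) + b • (y - z) := by module
  have hdiff : x - y = (x - z) - (y - z) := by abel
  simp only [smul_eq_mul]
  rw [hpoint, hdiff, norm_add_sq_real, norm_sub_sq_real (x - z), norm_smul, norm_smul,
    real_inner_smul_left, real_inner_smul_right, Real.norm_of_nonneg ha, Real.norm_of_nonneg hb]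
  ring

theorem strongConvexOn_add_sq_norm_sub [InnerProductSpace ℝ V] {s : Set V} {g : V → ℝ} {μ : ℝ}
    (hg : StrongConvexOn s μ g) (m : ℝ) (z : V) :
    StrongConvexOn s (μ + m) fun x => g x + m / 2 * ‖x - z‖ ^ 2 := by
  have h := UniformConvexOn.add hg (strongConvexOn_sq_norm_sub hg.1 m z)
  have hmod : ((fun ρ : ℝ => μ / 2 * ρ ^ 2) + fun ρ => m / 2 * ρ ^ 2)
      = fun ρ => (μ + m) / 2 * ρ ^ 2 := by
    ext ρ
    simp only [Pi.add_apply]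
    ring
  rwa [hmod] at h

end StronglyConvex

section Gradient

variable {V : Type*} [NormedAddCommGroup V] [InnerProductSpace ℝ V] [CompleteSpace V]
  {s : Set V} {g : V → ℝ} {G u v : V}

theorem hasDerivAt_comp_add_smul {h : V} {t : ℝ} (hg : HasGradientAt g G (u + t • h)) :
    HasDerivAt (fun τ : ℝ => g (u + τ • h)) ⟪G, h⟫ t := by
  have hline : HasDerivAt (fun τ : ℝ => u + τ • h) h t := by
    simpa using ((hasDerivAt_id t).smul_const h).const_add u
  have := hg.hasFDerivAt.comp_hasDerivAt t hline
  rwa [InnerProductSpace.toDual_apply_apply] at this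

theorem add_inner_add_sq_norm_sub_le {μ : ℝ} (hg : StrongConvexOn s μ g) (hu : u ∈ s)
    (hv : v ∈ s) (hgrad : HasGradientAt g G u) :
    g u + ⟪G, v - u⟫ + μ / 2 * ‖v - u‖ ^ 2 ≤ g v := by
  have hderiv : HasDerivAt (fun t : ℝ => g (u + t • (v - u))) ⟪G, v - u⟫ 0 :=
    hasDerivAt_comp_add_smul (by simpa using hgrad)
  have hslope := (hasDerivAt_iff_tendsto_slope_zero.1 hderiv).mono_left
    (nhdsWithin_mono 0 fun t (ht : 0 < t) => ht.ne')
  exact add_add_sq_norm_sub_le_of_tendsto_slope hg hu hv hslope fun t _ => by simp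

theorem le_add_inner_of_concaveOn (hg : ConcaveOn ℝ s g) (hu : u ∈ s) (hv : v ∈ s)
    (hgrad : HasGradientAt g G u) : g v ≤ g u + ⟪G, v - u⟫ := by
  have hneg : HasGradientAt (fun w => -g w) (-G) u := by
    rw [hasGradientAt_iff_hasFDerivAt, map_neg]
    exact hgrad.hasFDerivAt.neg
  have := add_inner_add_sq_norm_sub_le (strongConvexOn_zero.2 hg.neg) hu hv hneg
  rw [inner_neg_left] at this
  simp only [Pi.neg_apply] at this
  linarith

theorem mul_norm_sub_le_norm_gradient_add {μ : ℝ} (hg : StrongConvexOn s μ g) {p w : V}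
    (hp : p ∈ s) (hmin : IsMinOn g s p) (hu : u ∈ s) (hgrad : HasGradientAt g G u)
    (hw : ⟪w, p - u⟫ ≤ 0) : μ * ‖u - p‖ ≤ ‖G + w‖ := by
  have hgrow := add_sq_norm_sub_le_of_isMinOn hg hp hmin hu
  have hfirst := add_inner_add_sq_norm_sub_le hg hu hp hgrad
  have hcauchy := neg_le_of_abs_le (abs_real_inner_le_norm (G + w) (p - u))
  rw [inner_add_left] at hcauchy
  rw [norm_sub_rev p u] at hfirst hcauchy
  rcases (norm_nonneg (u - p)).eq_or_lt with h0 | h0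
  · simp only [← h0, mul_zero, norm_nonneg]
  · refine le_of_mul_le_mul_right ?_ h0
    linarith

theorem abs_sub_sub_inner_le_of_lipschitz_gradient (hs : Convex ℝ s) {g' : V → V} {L : ℝ}
    (hg : ∀ x ∈ s, HasGradientAt g (g' x) x) (hu : u ∈ s)
    (hL : ∀ x ∈ s, ‖g' x - g' u‖ ≤ L * ‖x - u‖) (hv : v ∈ s) :
    |g v - g u - ⟪g' u, v - u⟫| ≤ L / 2 * ‖v - u‖ ^ 2 := by
  have hderiv : ∀ t ∈ Icc (0 : ℝ) 1, HasDerivAt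
      (fun τ : ℝ => g (u + τ • (v - u)) - g u - τ * ⟪g' u, v - u⟫)
      (⟪g' (u + t • (v - u)), v - u⟫ - 1 * ⟪g' u, v - u⟫) t := fun t ht =>
    ((hasDerivAt_comp_add_smul (hg _ (hs.add_smul_sub_mem hu hv ht))).sub_const _).sub
      ((hasDerivAt_id t).mul_const _)
  have hbound : ∀ t ∈ Icc (0 : ℝ) 1,
      ‖⟪g' (u + t • (v - u)), v - u⟫ - 1 * ⟪g' u, v - u⟫‖ ≤ L / 2 * ‖v - u‖ ^ 2 * (2 * t) := by
    intro t ht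
    have hlip := hL _ (hs.add_smul_sub_mem hu hv ht)
    rw [add_sub_cancel_left, norm_smul, Real.norm_of_nonneg ht.1] at hlip
    rw [one_mul, ← inner_sub_left]
    refine (norm_inner_le_norm _ _).trans
      ((mul_le_mul_of_nonneg_right hlip (norm_nonneg _)).trans_eq ?_)
    ring
  have h := image_norm_le_of_norm_deriv_right_le_deriv_boundary
    (B := fun t => L / 2 * ‖v - u‖ ^ 2 * t ^ 2)
    (fun t ht => (hderiv t ht).continuousAt.continuousWithinAt)
    (fun t ht => (hderiv t (Ico_subset_Icc_self ht)).hasDerivWithinAt) (by simp)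
    (fun t => by simpa using (hasDerivAt_pow 2 t).const_mul (L / 2 * ‖v - u‖ ^ 2))
    (fun t ht => hbound t (Ico_subset_Icc_self ht)) (right_mem_Icc.2 zero_le_one)
  simpa using h

theorem strongConvexOn_neg_of_lipschitz_gradient (hs : Convex ℝ s) {g' : V → V} {L : ℝ}
    (hg : ∀ x ∈ s, HasGradientAt g (g' x) x)
    (hL : ∀ x ∈ s, ∀ y ∈ s, ‖g' x - g' y‖ ≤ L * ‖x - y‖) : StrongConvexOn s (-L) g := by
  refine ⟨hs, fun x hx y hy a b ha hb hab => ?_⟩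
  have hw := hs hx hy ha hb hab
  have hxw := neg_le_of_abs_le
    (abs_sub_sub_inner_le_of_lipschitz_gradient hs hg hw (fun p hp => hL p hp _ hw) hx)
  have hyw := neg_le_of_abs_le
    (abs_sub_sub_inner_le_of_lipschitz_gradient hs hg hw (fun p hp => hL p hp _ hw) hy)
  obtain rfl : a = 1 - b := eq_sub_of_add_eq hab
  have hxsub : x - ((1 - b) • x + b • y) = b • (x - y) := by module
  have hysub : y - ((1 - b) • x + b • y) = -((1 - b) • (x - y)) := by module
  rw [hxsub, real_inner_smul_right, norm_smul, Real.norm_of_nonneg hb] at hxw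
  rw [hysub, inner_neg_right, real_inner_smul_right, norm_neg, norm_smul,
    Real.norm_of_nonneg ha] at hyw
  simp only [smul_eq_mul]
  linarith [mul_le_mul_of_nonneg_left hxw ha, mul_le_mul_of_nonneg_left hyw hb]

end Gradient

theorem exists_le_div_of_forall_add_le {a : ℕ → ℝ} {p : ℕ → Prop} {m δ : ℝ} (hδ : 0 < δ)
    (hm : ∀ t, m ≤ a t) (hdec : ∀ t, ¬ p t → a (t + 1) + δ ≤ a t) :
    ∃ t : ℕ, (t : ℝ) ≤ (a 0 - m) / δ ∧ p t := by
  by_contra! hnot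
  have hlinear : ∀ t : ℕ, (t : ℝ) ≤ (a 0 - m) / δ + 1 → a t + t * δ ≤ a 0 := by
    intro t
    induction t with
    | zero => simp
    | succ t ih =>
      intro ht
      push_cast at ht ⊢
      linarith [hdec t (hnot t (by linarith)), ih (by linarith)]
  obtain ⟨t, htlt, htle⟩ : ∃ t : ℕ, (a 0 - m) / δ < t ∧ (t : ℝ) ≤ (a 0 - m) / δ + 1 :=
    ⟨⌊(a 0 - m) / δ⌋₊ + 1, by exact_mod_cast Nat.lt_floor_add_one _, by
      push_cast
      linarith [Nat.floor_le (div_nonneg (sub_nonneg.2 (hm 0)) hδ.le)]⟩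
  rw [div_lt_iff₀ hδ] at htlt
  linarith [hlinear t htle, hm t]

theorem inner_gradient_sub_nonneg_of_isMinOn {V : Type*} [NormedAddCommGroup V]
    [InnerProductSpace ℝ V] [CompleteSpace V] {s : Set V} {g : V → ℝ} {G u v : V}
    (hs : Convex ℝ s) (hu : u ∈ s) (hmin : IsMinOn g s u) (hgrad : HasGradientAt g G u)
    (hv : v ∈ s) : 0 ≤ ⟪G, v - u⟫ := by
  have h := hmin.localize.hasFDerivWithinAt_nonneg hgrad.hasFDerivAt.hasFDerivWithinAt
    (sub_mem_posTangentConeAt_of_segment_subset (hs.segment_subset hu hv))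
  rwa [InnerProductSpace.toDual_apply_apply] at h

section Projection

variable {n : ℕ} {S : Set (E n)}

theorem IsProj.inner_sub_le_zero (hS : Convex ℝ S) {u v w : E n} (h : IsProj S u v) (hw : w ∈ S) :
    ⟪u - v, w - v⟫ ≤ 0 := by
  have : Nonempty S := ⟨⟨v, h.1⟩⟩
  refine (norm_eq_iInf_iff_real_inner_le_zero hS h.1).1 (le_antisymm ?_ ?_) w hw
  · exact le_ciInf fun w => h.2 w w.2
  · exact ciInf_le ⟨0, by rintro _ ⟨w, rfl⟩; exact norm_nonneg _⟩ (⟨v, h.1⟩ : S)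

theorem IsProj.inv_smul_sub_sub_mem_normalCone (hS : Convex ℝ S) {c : ℝ} (hc : 0 < c)
    {x g u : E n} (h : IsProj S (x - c • g) u) : c⁻¹ • (x - u) - g ∈ normalCone S u := by
  intro w hw
  have hscale : c⁻¹ • (x - u) - g = c⁻¹ • (x - c • g - u) := by
    rw [sub_right_comm, smul_sub _ (x - u), inv_smul_smul₀ hc.ne']
  rw [hscale, real_inner_smul_left]
  exact mul_nonpos_of_nonneg_of_nonpos (inv_nonneg.2 hc.le) (h.inner_sub_le_zero hS hw)

end Projection

/-- The partial gradient of `f` in the primal variable. -/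
noncomputable abbrev gradX {n d : ℕ} (f : E n → E d → ℝ) (x : E n) (y : E d) : E n :=
  gradient (fun u => f u y) x

/-- The partial gradient of `f` in the dual variable. -/
noncomputable abbrev gradY {n d : ℕ} (f : E n → E d → ℝ) (x : E n) (y : E d) : E d :=
  gradient (fun v => f x v) y

/-- The proximal objective `Φ + (r/2) ‖· - z‖²`, which is `max_{y ∈ Y} F(·, y, z)`. -/
noncomputable def proxObjective {n d : ℕ} (f : E n → E d → ℝ) (Y : Set (E d)) (r : ℝ)
    (z x : E n) : ℝ :=
  valueFn f Y x + r / 2 * ‖x - z‖ ^ 2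

/-- A smooth nonconvex-concave minimax problem: `X` closed and convex, `Y` compact and nonempty,
`f` with `ℓ`-Lipschitz partial gradients and concave in `y`. Convexity of `Y` is part of the
concavity requirement once `X` is nonempty. -/
structure IsNCCProblem {n d : ℕ} (f : E n → E d → ℝ) (X : Set (E n)) (Y : Set (E d)) (ℓ : ℝ) :
    Prop where
  isClosed_X : IsClosed X
  convex_X : Convex ℝ X
  isCompact_Y : IsCompact Y
  nonempty_Y : Y.Nonempty
  smooth : IsSmoothOn f X Y ℓ
  concave : ∀ u ∈ X, ConcaveOn ℝ Y (f u)

variable {n d : ℕ} {f : E n → E d → ℝ} {X : Set (E n)} {Y : Set (E d)} {ℓ : ℝ}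

namespace IsSmoothOn

theorem hasGradientAt_gradX (hf : IsSmoothOn f X Y ℓ) (x : E n) (y : E d) :
    HasGradientAt (fun u => f u y) (gradX f x y) x :=
  DifferentiableAt.hasGradientAt <| ((hf.contDiff.differentiable one_ne_zero).comp
    (differentiable_id.prodMk (differentiable_const y))) x

theorem hasGradientAt_gradY (hf : IsSmoothOn f X Y ℓ) (x : E n) (y : E d) :
    HasGradientAt (fun v => f x v) (gradY f x y) y :=
  DifferentiableAt.hasGradientAt <| ((hf.contDiff.differentiable one_ne_zero).comp
    ((differentiable_const x).prodMk differentiable_id)) y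

theorem hasGradientAt_surrogate_x (hf : IsSmoothOn f X Y ℓ) (r : ℝ) (x : E n) (y : E d)
    (z : E n) :
    HasGradientAt (fun u => surrogate f r u y z) (gradX f x y + r • (x - z)) x := by
  rw [hasGradientAt_iff_hasFDerivAt]
  refine ((hf.hasGradientAt_gradX x y).hasFDerivAt.add
    (((hasFDerivAt_id x).sub_const z).norm_sq.const_mul (r / 2))).congr_fderiv ?_
  ext v
  simp only [toDual_gradient, id_eq, map_sub, ContinuousLinearMap.comp_id, add_apply, smul_apply,
    sub_apply, coe_innerSL_apply, nsmul_eq_mul, Nat.cast_ofNat, smul_eq_mul, map_add, map_smul,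
    InnerProductSpace.toDual_apply_apply]
  ring

theorem gradient_surrogate_x (hf : IsSmoothOn f X Y ℓ) (r : ℝ) (x : E n) (y : E d) (z : E n) :
    gradient (fun u => surrogate f r u y z) x = gradX f x y + r • (x - z) :=
  (hf.hasGradientAt_surrogate_x r x y z).gradient

theorem gradient_surrogate_y (hf : IsSmoothOn f X Y ℓ) (r : ℝ) (x : E n) (y : E d) (z : E n) :
    gradient (fun v => surrogate f r x v z) y = gradY f x y := by
  refine HasGradientAt.gradient (hasGradientAt_iff_hasFDerivAt.2 ?_)
  exact (hf.hasGradientAt_gradY x y).hasFDerivAt.add_const _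

theorem norm_gradX_sub_le (hf : IsSmoothOn f X Y ℓ) {x x' : E n} {y : E d} (hx : x ∈ X)
    (hx' : x' ∈ X) (hy : y ∈ Y) : ‖gradX f x y - gradX f x' y‖ ≤ ℓ * ‖x - x'‖ := by
  simpa using hf.lipschitz_x x hx x' hx' y hy y hy

theorem strongConvexOn_neg (hf : IsSmoothOn f X Y ℓ) (hX : Convex ℝ X) {y : E d} (hy : y ∈ Y) :
    StrongConvexOn X (-ℓ) fun x => f x y :=
  strongConvexOn_neg_of_lipschitz_gradient hX (fun x _ => hf.hasGradientAt_gradX x y)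
    fun _ hx _ hx' => hf.norm_gradX_sub_le hx hx' hy

theorem strongConvexOn_surrogate (hf : IsSmoothOn f X Y ℓ) (hX : Convex ℝ X) {y : E d}
    (hy : y ∈ Y) (r : ℝ) (z : E n) : StrongConvexOn X (r - ℓ) fun x => surrogate f r x y z := by
  rw [← neg_add_eq_sub]
  exact strongConvexOn_add_sq_norm_sub (hf.strongConvexOn_neg hX hy) r z

theorem mul_norm_sub_le_of_isMinOn_surrogate (hf : IsSmoothOn f X Y ℓ) (hX : Convex ℝ X) {r : ℝ}
    (hr : 0 ≤ r) {y y' : E d} {z z' p p' : E n} (hy : y ∈ Y) (hy' : y' ∈ Y) (hp : p ∈ X)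
    (hp' : p' ∈ X) (hmin : IsMinOn (fun x => surrogate f r x y z) X p)
    (hmin' : IsMinOn (fun x => surrogate f r x y' z') X p') :
    (r - ℓ) * ‖p - p'‖ ≤ ℓ * ‖y - y'‖ + r * ‖z - z'‖ := by
  have hopt := inner_gradient_sub_nonneg_of_isMinOn hX hp hmin
    (hf.hasGradientAt_surrogate_x r p y z) hp'
  have hbound := mul_norm_sub_le_norm_gradient_add (hf.strongConvexOn_surrogate hX hy' r z')
    hp' hmin' hp (hf.hasGradientAt_surrogate_x r p y' z') (w := -(gradX f p y + r • (p - z)))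
    (by rwa [inner_neg_left, neg_nonpos])
  have hdiff : gradX f p y' + r • (p - z') + -(gradX f p y + r • (p - z))
      = (gradX f p y' - gradX f p y) + r • (z - z') := by module
  have hlip := hf.lipschitz_x p hp p hp y' hy' y hy
  rw [sub_self, norm_zero, zero_add, norm_sub_rev y' y] at hlip
  calc (r - ℓ) * ‖p - p'‖ ≤ ‖(gradX f p y' - gradX f p y) + r • (z - z')‖ := hdiff ▸ hbound
    _ ≤ ‖gradX f p y' - gradX f p y‖ + r * ‖z - z'‖ := by
        simpa only [norm_smul, Real.norm_of_nonneg hr] using norm_add_le _ (r • (z - z'))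
    _ ≤ ℓ * ‖y - y'‖ + r * ‖z - z'‖ := add_le_add_left hlip _

theorem le_valueFn (hf : IsSmoothOn f X Y ℓ) (hY : IsCompact Y) (x : E n) {y : E d}
    (hy : y ∈ Y) : f x y ≤ valueFn f Y x :=
  le_csSup (hY.image (hf.contDiff.continuous.comp (Continuous.prodMk_right x))).bddAbove
    (mem_image_of_mem _ hy)

theorem continuous_valueFn (hf : IsSmoothOn f X Y ℓ) (hY : IsCompact Y) :
    Continuous (valueFn f Y) :=
  hY.continuous_sSup hf.contDiff.continuous

end IsSmoothOn

theorem valueFn_le (hY : Y.Nonempty) {x : E n} {b : ℝ} (h : ∀ y ∈ Y, f x y ≤ b) :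
    valueFn f Y x ≤ b :=
  csSup_le (hY.image _) (forall_mem_image.2 h)

theorem dualFn_eq_of_isMinOn {r : ℝ} {y : E d} {z p : E n} (hp : p ∈ X)
    (hmin : IsMinOn (fun x => surrogate f r x y z) X p) :
    dualFn f X r y z = surrogate f r p y z :=
  IsLeast.csInf_eq ⟨mem_image_of_mem _ hp, forall_mem_image.2 hmin⟩

namespace IsNCCProblem

theorem norm_sub_le_diam (P : IsNCCProblem f X Y ℓ) {y v : E d} (hy : y ∈ Y) (hv : v ∈ Y) :
    ‖y - v‖ ≤ Metric.diam Y := by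
  rw [← dist_eq_norm]
  exact Metric.dist_le_diam_of_mem P.isCompact_Y.isBounded hy hv

theorem strongConvexOn_neg_valueFn (P : IsNCCProblem f X Y ℓ) :
    StrongConvexOn X (-ℓ) (valueFn f Y) := by
  refine ⟨P.convex_X, fun x hx y hy a b ha hb hab => valueFn_le P.nonempty_Y fun v hv => ?_⟩
  refine ((P.smooth.strongConvexOn_neg P.convex_X hv).2 hx hy ha hb hab).trans ?_
  gcongr <;> exact P.smooth.le_valueFn P.isCompact_Y _ hv

theorem strongConvexOn_proxObjective (P : IsNCCProblem f X Y ℓ) (r : ℝ) (z : E n) :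
    StrongConvexOn X (r - ℓ) (proxObjective f Y r z) := by
  rw [← neg_add_eq_sub]
  exact strongConvexOn_add_sq_norm_sub P.strongConvexOn_neg_valueFn r z

theorem exists_isMinOn_surrogate (P : IsNCCProblem f X Y ℓ) {r : ℝ} (hr : ℓ < r)
    (hX : X.Nonempty) {y : E d} (hy : y ∈ Y) (z : E n) :
    ∃ p ∈ X, IsMinOn (fun x => surrogate f r x y z) X p :=
  exists_isMinOn_of_strongConvexOn (sub_pos.2 hr)
    (P.smooth.strongConvexOn_surrogate P.convex_X hy r z)
    (fun x _ => (P.smooth.hasGradientAt_surrogate_x r x y z).continuousAt.continuousWithinAt)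
    P.isClosed_X hX

theorem exists_isMinOn_proxObjective (P : IsNCCProblem f X Y ℓ) {r : ℝ} (hr : ℓ < r)
    (hX : X.Nonempty) (z : E n) : ∃ q ∈ X, IsMinOn (proxObjective f Y r z) X q := by
  refine exists_isMinOn_of_strongConvexOn (sub_pos.2 hr) (P.strongConvexOn_proxObjective r z)
    (Continuous.continuousOn ?_) P.isClosed_X hX
  exact (P.smooth.continuous_valueFn P.isCompact_Y).add (by fun_prop)

theorem sSup_surrogate (P : IsNCCProblem f X Y ℓ) (r : ℝ) (x z : E n) :
    sSup ((fun y => surrogate f r x y z) '' Y) = proxObjective f Y r z x := by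
  obtain ⟨y, hy, hmax⟩ := P.isCompact_Y.exists_isMaxOn P.nonempty_Y
    (P.smooth.contDiff.continuous.comp (Continuous.prodMk_right x)).continuousOn
  have hvalue : valueFn f Y x = f x y :=
    IsGreatest.csSup_eq ⟨mem_image_of_mem _ hy, forall_mem_image.2 hmax⟩
  rw [proxObjective, hvalue]
  exact IsGreatest.csSup_eq ⟨mem_image_of_mem _ hy,
    forall_mem_image.2 fun v hv => add_le_add_left (hmax hv) _⟩

theorem proxFn_eq_of_isMinOn (P : IsNCCProblem f X Y ℓ) {r : ℝ} {z q : E n} (hq : q ∈ X)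
    (hmin : IsMinOn (proxObjective f Y r z) X q) :
    proxFn f X Y r z = proxObjective f Y r z q := by
  simp only [proxFn, P.sSup_surrogate]
  exact IsLeast.csInf_eq ⟨mem_image_of_mem _ hq, forall_mem_image.2 hmin⟩

theorem dualFn_le_surrogate (P : IsNCCProblem f X Y ℓ) {r : ℝ} (hr : ℓ < r) {x : E n} {y : E d}
    (hx : x ∈ X) (hy : y ∈ Y) (z : E n) : dualFn f X r y z ≤ surrogate f r x y z := by
  obtain ⟨p, hp, hmin⟩ := P.exists_isMinOn_surrogate hr ⟨x, hx⟩ hy z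
  exact (dualFn_eq_of_isMinOn hp hmin).trans_le (hmin hx)

theorem proxFn_le_proxObjective (P : IsNCCProblem f X Y ℓ) {r : ℝ} (hr : ℓ < r) {x : E n}
    (hx : x ∈ X) (z : E n) : proxFn f X Y r z ≤ proxObjective f Y r z x := by
  obtain ⟨q, hq, hmin⟩ := P.exists_isMinOn_proxObjective hr ⟨x, hx⟩ z
  exact (P.proxFn_eq_of_isMinOn hq hmin).trans_le (hmin hx)

theorem surrogate_le_proxObjective (P : IsNCCProblem f X Y ℓ) (r : ℝ) (x z : E n) {y : E d}
    (hy : y ∈ Y) : surrogate f r x y z ≤ proxObjective f Y r z x :=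
  add_le_add_left (P.smooth.le_valueFn P.isCompact_Y x hy) _

theorem mul_sq_norm_sub_le_valueFn_sub (P : IsNCCProblem f X Y ℓ) {r : ℝ} {y : E d}
    {z p q : E n} (hy : y ∈ Y) (hp : p ∈ X) (hq : q ∈ X)
    (hpmin : IsMinOn (fun x => surrogate f r x y z) X p)
    (hqmin : IsMinOn (proxObjective f Y r z) X q) :
    (r - ℓ) * ‖q - p‖ ^ 2 ≤ valueFn f Y p - f p y := by
  have hgrowp := add_sq_norm_sub_le_of_isMinOn
    (P.smooth.strongConvexOn_surrogate P.convex_X hy r z) hp hpmin hq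
  have hgrowq := add_sq_norm_sub_le_of_isMinOn (P.strongConvexOn_proxObjective r z) hq hqmin hp
  have hqle := P.surrogate_le_proxObjective r q z hy
  rw [norm_sub_rev p q] at hgrowq
  have hgap : proxObjective f Y r z p - surrogate f r p y z = valueFn f Y p - f p y :=
    add_sub_add_right_eq_sub _ _ _
  linarith

theorem sInf_valueFn_le_potential (P : IsNCCProblem f X Y ℓ)
    (hbdd : BddBelow (valueFn f Y '' X)) {r : ℝ} (hr : ℓ < r) {x : E n} {y : E d} (hx : x ∈ X)
    (hy : y ∈ Y) (z : E n) : sInf (valueFn f Y '' X) ≤ potential f X Y r x y z := by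
  obtain ⟨q, hq, hqmin⟩ := P.exists_isMinOn_proxObjective hr ⟨x, hx⟩ z
  have hr0 : 0 < r := P.smooth.pos.trans hr
  have hinf : sInf (valueFn f Y '' X) ≤ proxObjective f Y r z q :=
    (csInf_le hbdd (mem_image_of_mem _ hq)).trans (le_add_of_nonneg_right (by positivity))
  rw [potential, P.proxFn_eq_of_isMinOn hq hqmin]
  linarith [P.dualFn_le_surrogate hr hx hy z, P.dualFn_le_surrogate hr hq hy z,
    P.surrogate_le_proxObjective r q z hy]

end IsNCCProblem

/-- One iteration of Smoothed GDA from `(x, y, z) ∈ X × Y × ℝⁿ` to `(x', y', z')`, with the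
gradients of the surrogate computed in terms of those of `f`. -/
structure IsGDAStep (f : E n → E d → ℝ) (X : Set (E n)) (Y : Set (E d)) (r c α β : ℝ)
    (x : E n) (y : E d) (z x' : E n) (y' : E d) (z' : E n) : Prop where
  mem_x : x ∈ X
  mem_y : y ∈ Y
  step_x : IsProj X (x - c • (gradX f x y + r • (x - z))) x'
  step_y : IsProj Y (y + α • gradY f x' y) y'
  step_z : z' = z + β • (x' - z)

theorem IsSmoothedGDA.isGDAStep {r c α β : ℝ} {x : ℕ → E n} {y : ℕ → E d} {z : ℕ → E n}
    (hG : IsSmoothedGDA f X Y r c α β x y z) (hf : IsSmoothOn f X Y ℓ) (t : ℕ) :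
    IsGDAStep f X Y r c α β (x t) (y t) (z t) (x (t + 1)) (y (t + 1)) (z (t + 1)) where
  mem_x := t.casesOn hG.init_x fun t => (hG.step_x t).1
  mem_y := t.casesOn hG.init_y fun t => (hG.step_y t).1
  step_x := by simpa only [hf.gradient_surrogate_x] using hG.step_x t
  step_y := by simpa only [hf.gradient_surrogate_y] using hG.step_y t
  step_z := hG.step_z t

theorem isGS_of_mem_normalCone {ε : ℝ} {u v : E n} {y w : E d} (hu : u ∈ X) (hy : y ∈ Y)
    (hv : v ∈ normalCone X u) (hw : w ∈ normalCone Y y) (hresx : ‖gradX f u y + v‖ ≤ ε)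
    (hresy : ‖-gradY f u y + w‖ ≤ ε) : IsGS f X Y ε u y := by
  refine ⟨hu, hy, (Metric.infDist_le_dist_of_mem (mem_image_of_mem _ hv)).trans ?_,
    (Metric.infDist_le_dist_of_mem (mem_image_of_mem _ hw)).trans ?_⟩
  · rwa [dist_zero_left]
  · rwa [dist_zero_left]

namespace IsNCCProblem

theorem valueFn_le_add_of_mem_normalCone (P : IsNCCProblem f X Y ℓ) {x : E n} {y w : E d}
    (hx : x ∈ X) (hy : y ∈ Y) (hw : w ∈ normalCone Y y) :
    valueFn f Y x ≤ f x y + Metric.diam Y * ‖-gradY f x y + w‖ := by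
  refine valueFn_le P.nonempty_Y fun v hv => ?_
  have hconc := le_add_inner_of_concaveOn (P.concave x hx) hy hv
    (P.smooth.hasGradientAt_gradY x y)
  have hcauchy := neg_le_of_abs_le (abs_real_inner_le_norm (-gradY f x y + w) (v - y))
  have hdiam := mul_le_mul_of_nonneg_right (P.norm_sub_le_diam hv hy)
    (norm_nonneg (-gradY f x y + w))
  rw [inner_add_left, inner_neg_left] at hcauchy
  linarith [hw v hv]

theorem mul_sq_norm_sub_le_of_mem_normalCone (P : IsNCCProblem f X Y ℓ) {u v p : E n} {y : E d}
    (hu : u ∈ X) (hy : y ∈ Y) (hv : v ∈ normalCone X u) (hp : p ∈ X)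
    (hpmin : IsMinOn (proxObjective f Y (2 * ℓ) u) X p) :
    ℓ * ‖p - u‖ ^ 2 ≤ valueFn f Y u - f u y + ‖gradX f u y + v‖ * ‖p - u‖ := by
  have hgrow := add_sq_norm_sub_le_of_isMinOn (P.strongConvexOn_proxObjective (2 * ℓ) u) hp
    hpmin hu
  have hfirst := add_inner_add_sq_norm_sub_le (P.smooth.strongConvexOn_neg P.convex_X hy) hu hp
    (P.smooth.hasGradientAt_gradX u y)
  have hcauchy := neg_le_of_abs_le (abs_real_inner_le_norm (gradX f u y + v) (p - u))
  rw [inner_add_left] at hcauchy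
  simp only [proxObjective, sub_self, norm_zero] at hgrow
  rw [norm_sub_rev u p] at hgrow
  linarith [hv p hp, P.smooth.le_valueFn P.isCompact_Y p hy]

theorem proxSet_valueFn_eq_singleton (P : IsNCCProblem f X Y ℓ) {u p : E n} (hp : p ∈ X)
    (hpmin : IsMinOn (proxObjective f Y (2 * ℓ) u) X p) :
    proxSet X (valueFn f Y) (1 / (2 * ℓ)) u = {p} := by
  have hcoef : 1 / (2 * (1 / (2 * ℓ))) = 2 * ℓ / 2 := by
    have := P.smooth.pos
    field_simp
  have hstrict : StrictConvexOn ℝ X (proxObjective f Y (2 * ℓ) u) :=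
    (P.strongConvexOn_proxObjective (2 * ℓ) u).strictConvexOn (by linarith [P.smooth.pos])
  ext w
  simp only [proxSet, hcoef, mem_ofPred_eq, mem_singleton_iff]
  refine ⟨fun hw => hstrict.eq_of_isMinOn hw.2 hpmin hw.1 hp, ?_⟩
  rintro rfl
  exact ⟨hp, hpmin⟩

theorem isOS_of_mem_normalCone (P : IsNCCProblem f X Y ℓ) {ε : ℝ} (hε : 0 < ε) {u v : E n}
    {y : E d} (hu : u ∈ X) (hy : y ∈ Y) (hv : v ∈ normalCone X u)
    (hres : ‖gradX f u y + v‖ ≤ ε / 4) (hgap : valueFn f Y u - f u y ≤ ε ^ 2 / (8 * ℓ)) :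
    IsOS f X Y ℓ ε u := by
  have hℓ := P.smooth.pos
  obtain ⟨p, hp, hpmin⟩ := P.exists_isMinOn_proxObjective (r := 2 * ℓ) (by linarith) ⟨u, hu⟩ u
  refine ⟨hu, p, P.proxSet_valueFn_eq_singleton hp hpmin, ?_⟩
  have hbound := P.mul_sq_norm_sub_le_of_mem_normalCone hu hy hv hp hpmin
  have hslope := mul_le_mul_of_nonneg_right hres (norm_nonneg (p - u))
  rw [le_div_iff₀ (by positivity)] at hgap ⊢
  by_contra! hlt
  have hlt' : ε * ε < (‖p - u‖ * (2 * ℓ)) * (‖p - u‖ * (2 * ℓ)) :=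
    mul_self_lt_mul_self hε.le hlt
  have hlt'' : ε * (2 * ℓ * ‖p - u‖) < (‖p - u‖ * (2 * ℓ)) * (2 * ℓ * ‖p - u‖) :=
    mul_lt_mul_of_pos_right hlt (by linarith)
  linarith [mul_le_mul_of_nonneg_left hbound hℓ.le, mul_le_mul_of_nonneg_left hslope hℓ.le]

theorem surrogate_add_inner_le_of_isMinOn (P : IsNCCProblem f X Y ℓ) {r : ℝ} {y y' : E d}
    {z p p' : E n} (hy : y ∈ Y) (hy' : y' ∈ Y) (hp' : p' ∈ X)
    (hmin : IsMinOn (fun x => surrogate f r x y z) X p) :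
    surrogate f r p y z + ⟪gradY f p' y', y' - y⟫ ≤ surrogate f r p' y' z := by
  have hconc := le_add_inner_of_concaveOn (P.concave p' hp') hy' hy
    (P.smooth.hasGradientAt_gradY p' y')
  have hle : surrogate f r p y z ≤ surrogate f r p' y z := hmin hp'
  rw [← neg_sub y' y, inner_neg_right] at hconc
  simp only [surrogate] at hle ⊢
  linarith

theorem proxFn_sub_dualFn_le (P : IsNCCProblem f X Y ℓ) {r : ℝ} (hr : ℓ < r) {y : E d}
    (hy : y ∈ Y) {z z' p q : E n} (hp : p ∈ X) (hq : q ∈ X)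
    (hpmin : IsMinOn (fun x => surrogate f r x y z') X p)
    (hqmin : IsMinOn (proxObjective f Y r z) X q) :
    proxFn f X Y r z' - dualFn f X r y z'
      ≤ proxFn f X Y r z - dualFn f X r y z + r * ⟪z' - z, p - q⟫ := by
  have hdual := P.dualFn_le_surrogate hr hp hy z
  have hprox := P.proxFn_le_proxObjective hr hq z'
  rw [dualFn_eq_of_isMinOn hp hpmin, P.proxFn_eq_of_isMinOn hq hqmin]
  have hpz : p - z' = (p - z) - (z' - z) := by abel
  have hqz : q - z' = (q - z) - (z' - z) := by abel
  have hinner : ⟪z' - z, p - q⟫ = ⟪z' - z, p - z⟫ - ⟪z' - z, q - z⟫ := by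
    rw [← inner_sub_right, sub_sub_sub_cancel_right]
  simp only [surrogate, proxObjective] at hdual hprox ⊢
  rw [hqz, norm_sub_sq_real, real_inner_comm] at hprox
  rw [hinner, hpz, norm_sub_sq_real, real_inner_comm]
  linarith

end IsNCCProblem

namespace IsGDAStep

variable {r c α β : ℝ} {x x' z z' : E n} {y y' : E d}

theorem exists_mem_normalCone_x (h : IsGDAStep f X Y r c α β x y z x' y' z')
    (P : IsNCCProblem f X Y ℓ) (hr : ℓ ≤ r) (hc : 0 < c) (hcr : c * (r + ℓ) ≤ 1) :
    ∃ v ∈ normalCone X x', ‖gradX f x' y + r • (x' - z) + v‖ ≤ c⁻¹ * ‖x - x'‖ := by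
  refine ⟨_, h.step_x.inv_smul_sub_sub_mem_normalCone P.convex_X hc, ?_⟩
  have hℓ := P.smooth.pos
  have hcr' : 0 ≤ c⁻¹ - r := by
    rw [sub_nonneg, le_inv_comm₀ (by linarith) hc, ← one_div, le_div_iff₀ (by linarith)]
    linarith [mul_pos hc hℓ]
  have hsum : gradX f x' y + r • (x' - z) + (c⁻¹ • (x - x') - (gradX f x y + r • (x - z)))
      = (gradX f x' y - gradX f x y) + (c⁻¹ - r) • (x - x') := by module
  have hlip := P.smooth.norm_gradX_sub_le h.step_x.1 h.mem_x h.mem_y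
  rw [norm_sub_rev x' x] at hlip
  calc _ = ‖(gradX f x' y - gradX f x y) + (c⁻¹ - r) • (x - x')‖ := congrArg norm hsum
    _ ≤ ℓ * ‖x - x'‖ + (c⁻¹ - r) * ‖x - x'‖ :=
        norm_add_le_of_le hlip (by rw [norm_smul, Real.norm_of_nonneg hcr'])
    _ ≤ c⁻¹ * ‖x - x'‖ := by linarith [mul_le_mul_of_nonneg_right hr (norm_nonneg (x - x'))]

theorem mul_norm_sub_le_of_isMinOn_surrogate (h : IsGDAStep f X Y r c α β x y z x' y' z')
    (P : IsNCCProblem f X Y ℓ) (hr : ℓ ≤ r) (hc : 0 < c) (hcr : c * (r + ℓ) ≤ 1) {p : E n}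
    (hp : p ∈ X) (hpmin : IsMinOn (fun x => surrogate f r x y z) X p) :
    (r - ℓ) * ‖x' - p‖ ≤ c⁻¹ * ‖x - x'‖ := by
  obtain ⟨v, hv, hres⟩ := h.exists_mem_normalCone_x P hr hc hcr
  exact (mul_norm_sub_le_norm_gradient_add
    (P.smooth.strongConvexOn_surrogate P.convex_X h.mem_y r z) hp hpmin h.step_x.1
    (P.smooth.hasGradientAt_surrogate_x r x' y z) (hv p hp)).trans hres

theorem exists_mem_normalCone_x_norm_gradX_add_le (h : IsGDAStep f X Y r c α β x y z x' y' z')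
    (P : IsNCCProblem f X Y ℓ) (hr : ℓ ≤ r) (hc : 0 < c) (hcr : c * (r + ℓ) ≤ 1) :
    ∃ v ∈ normalCone X x',
      ‖gradX f x' y' + v‖ ≤ c⁻¹ * ‖x - x'‖ + ℓ * ‖y' - y‖ + r * ‖x' - z‖ := by
  obtain ⟨v, hv, hres⟩ := h.exists_mem_normalCone_x P hr hc hcr
  refine ⟨v, hv, ?_⟩
  have hlip := P.smooth.lipschitz_x x' h.step_x.1 x' h.step_x.1 y' h.step_y.1 y h.mem_y
  rw [sub_self, norm_zero, zero_add] at hlip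
  have hsum : gradX f x' y' + v
      = (gradX f x' y + r • (x' - z) + v) + (gradX f x' y' - gradX f x' y) - r • (x' - z) := by
    abel
  rw [hsum]
  refine norm_sub_le_of_le (norm_add_le_of_le hres hlip) ?_
  rw [norm_smul, Real.norm_of_nonneg (P.smooth.pos.le.trans hr)]

theorem exists_mem_normalCone_y (h : IsGDAStep f X Y r c α β x y z x' y' z')
    (P : IsNCCProblem f X Y ℓ) (hα : 0 < α) :
    ∃ w ∈ normalCone Y y', ‖-gradY f x' y' + w‖ ≤ (α⁻¹ + ℓ) * ‖y' - y‖ := by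
  have hstep : IsProj Y (y - α • -gradY f x' y) y' := by
    simpa only [smul_neg, sub_neg_eq_add] using h.step_y
  refine ⟨_, hstep.inv_smul_sub_sub_mem_normalCone (P.concave x' h.step_x.1).1 hα, ?_⟩
  have hlip := P.smooth.lipschitz_y x' h.step_x.1 x' h.step_x.1 y h.mem_y y' h.step_y.1
  rw [sub_self, norm_zero, zero_add, norm_sub_rev y y'] at hlip
  have hsum : -gradY f x' y' + (α⁻¹ • (y - y') - -gradY f x' y)
      = (gradY f x' y - gradY f x' y') + α⁻¹ • (y - y') := by abel
  rw [hsum, add_comm α⁻¹, add_mul]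
  refine norm_add_le_of_le hlip ?_
  rw [norm_smul, Real.norm_of_nonneg (inv_nonneg.2 hα.le), norm_sub_rev]

theorem inv_mul_sq_norm_sub_le_inner_gradY (h : IsGDAStep f X Y r c α β x y z x' y' z')
    (P : IsNCCProblem f X Y ℓ) (hα : 0 < α) :
    α⁻¹ * ‖y' - y‖ ^ 2 ≤ ⟪gradY f x' y, y' - y⟫ := by
  have hobtuse := h.step_y.inner_sub_le_zero (P.concave x' h.step_x.1).1 h.mem_y
  have hsum : y + α • gradY f x' y - y' = α • gradY f x' y - (y' - y) := by abel
  rw [hsum, ← neg_sub y' y, inner_neg_right, inner_sub_left, real_inner_smul_left,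
    real_inner_self_eq_norm_sq] at hobtuse
  rw [inv_mul_le_iff₀ hα]
  linarith

theorem valueFn_le (h : IsGDAStep f X Y r c α β x y z x' y' z') (P : IsNCCProblem f X Y ℓ)
    (hα : 0 < α) {u : E n} (hu : u ∈ X) :
    valueFn f Y u ≤ f u y' + Metric.diam Y * ((α⁻¹ + ℓ) * ‖y' - y‖ + ℓ * ‖u - x'‖) := by
  obtain ⟨w, hw, hres⟩ := h.exists_mem_normalCone_y P hα
  refine (P.valueFn_le_add_of_mem_normalCone hu h.step_y.1 hw).trans ?_
  have hlip := P.smooth.lipschitz_y x' h.step_x.1 u hu y' h.step_y.1 y' h.step_y.1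
  rw [sub_self, norm_zero, add_zero, norm_sub_rev x' u] at hlip
  have hsum : -gradY f u y' + w
      = (-gradY f x' y' + w) + (gradY f x' y' - gradY f u y') := by abel
  rw [hsum]
  gcongr
  exact norm_add_le_of_le hres hlip

theorem surrogate_add_sq_norm_sub_le (h : IsGDAStep f X Y r c α β x y z x' y' z')
    (P : IsNCCProblem f X Y ℓ) (hc : 0 < c) (hcr : c * (r + ℓ) ≤ 1) :
    surrogate f r x' y z + (r + ℓ) / 2 * ‖x - x'‖ ^ 2 ≤ surrogate f r x y z := by
  have hdescent := le_of_abs_le (abs_sub_sub_inner_le_of_lipschitz_gradient P.convex_X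
    (fun u _ => P.smooth.hasGradientAt_gradX u y) h.mem_x
    (fun u hu => P.smooth.norm_gradX_sub_le hu h.mem_x h.mem_y) h.step_x.1)
  have hobtuse := h.step_x.inv_smul_sub_sub_mem_normalCone P.convex_X hc x h.mem_x
  have hcr' : r + ℓ ≤ c⁻¹ := by
    rwa [← one_div, le_div_iff₀ hc, mul_comm]
  have hquad := norm_sub_sq_real (x - z) (x - x')
  rw [sub_sub_sub_cancel_left] at hquad
  rw [inner_sub_left, inner_add_left, real_inner_smul_left, real_inner_smul_left,
    real_inner_self_eq_norm_sq] at hobtuse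
  rw [← neg_sub x x', inner_neg_right, norm_neg] at hdescent
  simp only [surrogate]
  rw [hquad]
  linarith [mul_le_mul_of_nonneg_right hcr' (sq_nonneg ‖x - x'‖)]

end IsGDAStep

/-- Step sizes of Smoothed GDA for which the potential decreases up to noise. The constant `K`
bounds `r`, `c⁻¹` and `α⁻¹` in units of `ℓ`. -/
structure AdmissibleStepSizes (K ℓ r c α β : ℝ) : Prop where
  r_lower : 3 * ℓ ≤ r
  c_pos : 0 < c
  c_upper : c * (r + ℓ) ≤ 1
  α_pos : 0 < α
  α_upper : 11 * ℓ * α ≤ 1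
  α_upper_sq : 4 * ℓ * α ≤ (c * (r - ℓ)) ^ 2
  β_pos : 0 < β
  β_upper : β ≤ 1 / 36
  primal_le : r + ℓ + c⁻¹ ≤ K * ℓ
  dual_le : α⁻¹ + 2 * ℓ ≤ K * ℓ

theorem StepSizes.admissible {κ γ a r c α β : ℝ} (hs : StepSizes κ γ a ℓ r c α β) (hℓ : 0 < ℓ)
    (hγ : 0 < γ) (ha : 0 < a) :
    AdmissibleStepSizes (κ + 2 + 1 / γ + 1 / a) ℓ r c α β := by
  have hr := hs.r_lower
  have hrℓ : 0 < r - ℓ := by linarith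
  have hc : 0 < c := (div_pos hγ hℓ).trans_le hs.c_lower
  have hα : 0 < α := (div_pos ha hℓ).trans_le hs.α_lower
  have hcinv : c⁻¹ ≤ 1 / γ * ℓ :=
    (inv_anti₀ (div_pos hγ hℓ) hs.c_lower).trans_eq (by rw [inv_div, one_div_mul_eq_div])
  have hαinv : α⁻¹ ≤ 1 / a * ℓ :=
    (inv_anti₀ (div_pos ha hℓ) hs.α_lower).trans_eq (by rw [inv_div, one_div_mul_eq_div])
  have hα₁ := (le_div_iff₀ (by positivity)).1 (hs.α_upper.trans (min_le_left _ _))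
  have hα₂ := (le_div_iff₀ (by positivity)).1 (hs.α_upper.trans (min_le_right _ _))
  have hγℓ : 0 < 1 / γ * ℓ := by positivity
  have haℓ : 0 < 1 / a * ℓ := by positivity
  exact
    { r_lower := hr.le
      c_pos := hc
      c_upper := ((lt_div_iff₀ (by linarith)).1 hs.c_upper).le
      α_pos := hα
      α_upper := by linarith
      α_upper_sq := by
        have hone : 1 ≤ (1 + c * (r - ℓ)) ^ 2 :=
          one_le_pow₀ (by linarith [mul_pos hc hrℓ])
        linarith [mul_le_mul_of_nonneg_left hone (by positivity : 0 ≤ 4 * ℓ * α)]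
      β_pos := hs.β_pos
      β_upper := hs.β_upper.trans (min_le_left _ _)
      primal_le := by linarith [hs.r_upper]
      dual_le := by linarith [hs.r_upper] }

namespace AdmissibleStepSizes

variable {K r c α β : ℝ}

theorem two_mul_coupling_le (A : AdmissibleStepSizes K ℓ r c α β) (hℓ : 0 < ℓ)
    {δ η e s : ℝ} (hη : 0 ≤ η) (hs : 0 ≤ s) (he : e ≤ η / 2 + s) (hsδ : (r - ℓ) * s ≤ c⁻¹ * δ) :
    2 * ℓ * (e + η) * η + ℓ * η ^ 2 ≤ α⁻¹ * η ^ 2 + ℓ * δ ^ 2 := by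
  have hα := A.α_pos
  have hrℓ : 0 < r - ℓ := by linarith [A.r_lower]
  have hαinv : 11 * ℓ ≤ α⁻¹ := by
    rw [← one_div, le_div_iff₀ hα]
    exact A.α_upper
  have hcsδ : c * (r - ℓ) * s ≤ δ := by
    rwa [le_inv_mul_iff₀ A.c_pos, ← mul_assoc] at hsδ
  have hsq : 4 * ℓ * α * s ^ 2 ≤ δ ^ 2 :=
    calc 4 * ℓ * α * s ^ 2 ≤ (c * (r - ℓ)) ^ 2 * s ^ 2 :=
          mul_le_mul_of_nonneg_right A.α_upper_sq (sq_nonneg s)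
      _ = (c * (r - ℓ) * s) ^ 2 := (mul_pow _ _ _).symm
      _ ≤ δ ^ 2 := pow_le_pow_left₀ (by have := A.c_pos; positivity) hcsδ 2
  have hyoung : 2 * ℓ * s * η ≤ α⁻¹ / 4 * η ^ 2 + ℓ * (4 * ℓ * α * s ^ 2) := by
    have hsquare : α⁻¹ / 4 * η ^ 2 + ℓ * (4 * ℓ * α * s ^ 2) - 2 * ℓ * s * η
        = α * (α⁻¹ * η - 4 * ℓ * s) ^ 2 / 4 := by
      field_simp
      ring
    have hnonneg : 0 ≤ α * (α⁻¹ * η - 4 * ℓ * s) ^ 2 / 4 := by positivity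
    linarith
  linarith [mul_le_mul_of_nonneg_right he (mul_nonneg hℓ.le hη),
    mul_le_mul_of_nonneg_right hαinv (sq_nonneg η), mul_le_mul_of_nonneg_left hsq hℓ.le,
    mul_nonneg hℓ.le (sq_nonneg η)]

theorem two_mul_smoothing_le (A : AdmissibleStepSizes K ℓ r c α β) (hℓ : 0 < ℓ) (w G : ℝ) :
    2 * r * β * w * (G + 3 / 2 * β * w) + ℓ * β * w ^ 2
      ≤ r * β * (1 - β / 2) * w ^ 2 + 3 * β * ((r - ℓ) * G ^ 2) := by
  have hβ := A.β_pos
  have hr : 0 < r := by linarith [A.r_lower]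
  have hyoung : 2 * r * β * w * G ≤ r * β * w ^ 2 / 2 + 3 * β * ((r - ℓ) * G ^ 2) := by
    have hsquare : 0 ≤ r * β * (w - 2 * G) ^ 2 := by positivity
    have hslack : 0 ≤ β * G ^ 2 * (r - 3 * ℓ) :=
      mul_nonneg (by positivity) (sub_nonneg.2 A.r_lower)
    linarith
  have hcoef : ℓ + 3 * r * β + r / 2 ≤ r * (1 - β / 2) := by
    linarith [A.r_lower, mul_le_mul_of_nonneg_left A.β_upper hr.le]
  linarith [mul_le_mul_of_nonneg_right hcoef (mul_nonneg hβ.le (sq_nonneg w))]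

theorem mul_dual_error_le (A : AdmissibleStepSizes K ℓ r c α β) (hℓ : 0 < ℓ) {D δ η e s g : ℝ}
    (hD : 0 ≤ D) (hδ : 0 ≤ δ) (hη : 0 ≤ η) (hs : 0 ≤ s) (he : e ≤ η / 2 + s)
    (hsδ : (r - ℓ) * s ≤ c⁻¹ * δ) (hg : g ≤ D * ((α⁻¹ + ℓ) * η + ℓ * e)) :
    3 * β * g ≤ ℓ / 2 * δ ^ 2 + ℓ / 2 * η ^ 2 + 9 * K ^ 2 * ℓ * β ^ 2 * D ^ 2 := by
  have hr := A.r_lower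
  have hβ := A.β_pos
  have hlinear : (α⁻¹ + ℓ) * η + ℓ * e ≤ K * ℓ * (η + δ) := by
    have hℓs : ℓ * s ≤ c⁻¹ * δ :=
      (mul_le_mul_of_nonneg_right (by linarith) hs).trans hsδ
    have hcK : c⁻¹ ≤ K * ℓ := by linarith [A.primal_le]
    linarith [mul_le_mul_of_nonneg_left he hℓ.le, mul_le_mul_of_nonneg_right A.dual_le hη,
      mul_le_mul_of_nonneg_right hcK hδ, mul_nonneg hℓ.le hη]
  have hbound : 3 * β * g ≤ 3 * β * (D * (K * ℓ * (η + δ))) := by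
    gcongr
    exact hg.trans (mul_le_mul_of_nonneg_left hlinear hD)
  linarith [mul_nonneg hℓ.le (sq_nonneg (η - 3 * β * D * K)),
    mul_nonneg hℓ.le (sq_nonneg (δ - 3 * β * D * K))]

theorem one_le (A : AdmissibleStepSizes K ℓ r c α β) (hℓ : 0 < ℓ) : 1 ≤ K := by
  refine le_of_mul_le_mul_right ?_ hℓ
  linarith [A.dual_le, inv_pos.2 A.α_pos]

end AdmissibleStepSizes

theorem IsSmoothOn.norm_sub_le_of_isMinOn_surrogate (hf : IsSmoothOn f X Y ℓ) (hX : Convex ℝ X)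
    {r : ℝ} (hr : 3 * ℓ ≤ r) {y y' : E d} {z z' p p' : E n} (hy : y ∈ Y) (hy' : y' ∈ Y)
    (hp : p ∈ X) (hp' : p' ∈ X) (hmin : IsMinOn (fun x => surrogate f r x y z) X p)
    (hmin' : IsMinOn (fun x => surrogate f r x y' z') X p') :
    ‖p - p'‖ ≤ ‖y - y'‖ / 2 + 3 / 2 * ‖z - z'‖ := by
  have hℓ := hf.pos
  have hbound := hf.mul_norm_sub_le_of_isMinOn_surrogate hX (by linarith) hy hy' hp hp' hmin hmin'
  refine le_of_mul_le_mul_left (hbound.trans ?_) (by linarith : 0 < r - ℓ)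
  linarith [mul_nonneg (sub_nonneg.2 hr) (norm_nonneg (y - y')),
    mul_nonneg (sub_nonneg.2 hr) (norm_nonneg (z - z'))]

namespace IsGDAStep

variable {K r c α β : ℝ} {x x' z z' : E n} {y y' : E d}

theorem surrogate_sub_two_mul_dualFn_le (h : IsGDAStep f X Y r c α β x y z x' y' z')
    (P : IsNCCProblem f X Y ℓ) (hr : ℓ < r) (hα : 0 < α) {p : E n} (hp : p ∈ X)
    (hpmin : IsMinOn (fun x => surrogate f r x y' z) X p) :
    surrogate f r x' y' z - 2 * dualFn f X r y' z + α⁻¹ * ‖y' - y‖ ^ 2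
      ≤ surrogate f r x' y z - 2 * dualFn f X r y z
        + 2 * ℓ * (‖p - x'‖ + ‖y' - y‖) * ‖y' - y‖ := by
  obtain ⟨p₀, hp₀, hp₀min⟩ := P.exists_isMinOn_surrogate hr ⟨x', h.step_x.1⟩ h.mem_y z
  have hconc := le_add_inner_of_concaveOn (P.concave x' h.step_x.1) h.mem_y h.step_y.1
    (P.smooth.hasGradientAt_gradY x' y)
  have hdual := P.surrogate_add_inner_le_of_isMinOn h.mem_y h.step_y.1 hp hp₀min
  have hascent := h.inv_mul_sq_norm_sub_le_inner_gradY P hα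
  have hlip : ⟪gradY f x' y - gradY f p y', y' - y⟫
      ≤ ℓ * (‖p - x'‖ + ‖y' - y‖) * ‖y' - y‖ := by
    refine (real_inner_le_norm _ _).trans (mul_le_mul_of_nonneg_right ?_ (norm_nonneg _))
    rw [norm_sub_rev p, norm_sub_rev y']
    exact P.smooth.lipschitz_y x' h.step_x.1 p hp y h.mem_y y' h.step_y.1
  rw [dualFn_eq_of_isMinOn hp hpmin, dualFn_eq_of_isMinOn hp₀ hp₀min]
  rw [inner_sub_left] at hlip
  simp only [surrogate] at hdual ⊢
  linarith

theorem potential_step_z_le (h : IsGDAStep f X Y r c α β x y z x' y' z')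
    (P : IsNCCProblem f X Y ℓ) (hr : ℓ < r) (hβ : 0 ≤ β) {p q : E n} (hp : p ∈ X) (hq : q ∈ X)
    (hpmin : IsMinOn (fun x => surrogate f r x y' z') X p)
    (hqmin : IsMinOn (proxObjective f Y r z) X q) :
    potential f X Y r x' y' z' + r * β * (1 - β / 2) * ‖x' - z‖ ^ 2
      ≤ potential f X Y r x' y' z + 2 * r * β * ‖x' - z‖ * ‖p - q‖ := by
  have hgap := P.proxFn_sub_dualFn_le hr h.step_y.1 hp hq hpmin hqmin
  have hinner : ⟪z' - z, p - q⟫ ≤ β * ‖x' - z‖ * ‖p - q‖ := by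
    refine (real_inner_le_norm _ _).trans_eq ?_
    rw [h.step_z, add_sub_cancel_left, norm_smul, Real.norm_of_nonneg hβ]
  have hnorm : ‖x' - z'‖ ^ 2 = (1 - β) ^ 2 * ‖x' - z‖ ^ 2 := by
    have hsub : x' - z' = (1 - β) • (x' - z) := by rw [h.step_z]; module
    rw [hsub, norm_smul, mul_pow, Real.norm_eq_abs, sq_abs]
  have hr0 : 0 ≤ r := P.smooth.pos.le.trans hr.le
  simp only [potential, surrogate]
  rw [hnorm]
  linarith [mul_le_mul_of_nonneg_left hinner hr0]

theorem norm_sub_le_of_isMinOn_step_y (h : IsGDAStep f X Y r c α β x y z x' y' z')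
    (P : IsNCCProblem f X Y ℓ) (hr : 3 * ℓ ≤ r) {p p' : E n} (hp : p ∈ X) (hp' : p' ∈ X)
    (hpmin : IsMinOn (fun x => surrogate f r x y z) X p)
    (hpmin' : IsMinOn (fun x => surrogate f r x y' z) X p') :
    ‖p' - x'‖ ≤ ‖y' - y‖ / 2 + ‖x' - p‖ := by
  have htrack := P.smooth.norm_sub_le_of_isMinOn_surrogate P.convex_X hr h.step_y.1 h.mem_y
    hp' hp hpmin' hpmin
  rw [sub_self, norm_zero, mul_zero, add_zero] at htrack
  exact (norm_sub_le_norm_sub_add_norm_sub p' p x').trans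
    (add_le_add htrack (norm_sub_rev p x').le)

theorem norm_sub_le_of_isMinOn_step_z (h : IsGDAStep f X Y r c α β x y z x' y' z')
    (P : IsNCCProblem f X Y ℓ) (hr : 3 * ℓ ≤ r) (hβ : 0 ≤ β) {p p' : E n} (hp : p ∈ X)
    (hp' : p' ∈ X) (hpmin : IsMinOn (fun x => surrogate f r x y' z) X p)
    (hpmin' : IsMinOn (fun x => surrogate f r x y' z') X p') (q : E n) :
    ‖p' - q‖ ≤ ‖q - p‖ + 3 / 2 * β * ‖x' - z‖ := by
  have htrack := P.smooth.norm_sub_le_of_isMinOn_surrogate P.convex_X hr h.step_y.1 h.step_y.1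
    hp hp' hpmin hpmin'
  have hz : ‖z - z'‖ = β * ‖x' - z‖ := by
    rw [h.step_z, sub_add_cancel_left, norm_neg, norm_smul, Real.norm_of_nonneg hβ]
  rw [sub_self, norm_zero, zero_div, zero_add, hz, ← mul_assoc] at htrack
  rw [norm_sub_rev p' q]
  exact (norm_sub_le_norm_sub_add_norm_sub q p p').trans (add_le_add_right htrack _)

theorem potential_add_le (h : IsGDAStep f X Y r c α β x y z x' y' z')
    (P : IsNCCProblem f X Y ℓ) (A : AdmissibleStepSizes K ℓ r c α β) :
    potential f X Y r x' y' z'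
        + (ℓ / 2 * ‖x - x'‖ ^ 2 + ℓ / 2 * ‖y' - y‖ ^ 2 + ℓ * β * ‖x' - z‖ ^ 2)
      ≤ potential f X Y r x y z + 9 * K ^ 2 * ℓ * β ^ 2 * Metric.diam Y ^ 2 := by
  have hℓ := P.smooth.pos
  have hr := A.r_lower
  have hrℓ : ℓ < r := by linarith
  have hX : X.Nonempty := ⟨x, h.mem_x⟩
  obtain ⟨p, hp, hpmin⟩ := P.exists_isMinOn_surrogate hrℓ hX h.mem_y z
  obtain ⟨p₁, hp₁, hp₁min⟩ := P.exists_isMinOn_surrogate hrℓ hX h.step_y.1 z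
  obtain ⟨p₂, hp₂, hp₂min⟩ := P.exists_isMinOn_surrogate hrℓ hX h.step_y.1 z'
  obtain ⟨q, hq, hqmin⟩ := P.exists_isMinOn_proxObjective hrℓ hX z
  have hxp := h.mul_norm_sub_le_of_isMinOn_surrogate P hrℓ.le A.c_pos A.c_upper hp hpmin
  have hp₁x := h.norm_sub_le_of_isMinOn_step_y P hr hp hp₁ hpmin hp₁min
  have hp₂q := h.norm_sub_le_of_isMinOn_step_z P hr A.β_pos.le hp₁ hp₂ hp₁min hp₂min q
  have herror := (P.mul_sq_norm_sub_le_valueFn_sub h.step_y.1 hp₁ hq hp₁min hqmin).trans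
    (sub_le_iff_le_add'.2 (h.valueFn_le P A.α_pos hp₁))
  have hprimal := h.surrogate_add_sq_norm_sub_le P A.c_pos A.c_upper
  have hdual := h.surrogate_sub_two_mul_dualFn_le P hrℓ A.α_pos hp₁ hp₁min
  have hsmooth := h.potential_step_z_le P hrℓ A.β_pos.le hp₂ hq hp₂min hqmin
  have hdistance := mul_le_mul_of_nonneg_left hp₂q
    (by have := A.β_pos; have := hℓ.trans hrℓ; positivity : 0 ≤ 2 * r * β * ‖x' - z‖)
  simp only [potential] at hsmooth ⊢
  linarith [mul_nonneg (by linarith : 0 ≤ r - 3 * ℓ) (sq_nonneg ‖x - x'‖),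
    A.two_mul_coupling_le hℓ (norm_nonneg _) (norm_nonneg _) hp₁x hxp,
    A.two_mul_smoothing_le hℓ ‖x' - z‖ ‖q - p₁‖,
    A.mul_dual_error_le hℓ Metric.diam_nonneg (norm_nonneg _) (norm_nonneg _) (norm_nonneg _)
      hp₁x hxp herror]

theorem isGS_and_isOS_of_norm_le (h : IsGDAStep f X Y r c α β x y z x' y' z')
    (P : IsNCCProblem f X Y ℓ) (A : AdmissibleStepSizes K ℓ r c α β) {ε ρ : ℝ} (hε : 0 < ε)
    (hρ : K * ℓ * ρ ≤ ε / 4) (hx : ‖x - x'‖ ≤ ρ) (hy : ‖y' - y‖ ≤ ρ) (hz : ‖x' - z‖ ≤ ρ)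
    (hdiam : K * ℓ * (Metric.diam Y * ‖y' - y‖) ≤ ε ^ 2 / (8 * ℓ)) :
    IsGS f X Y ε x' y' ∧ IsOS f X Y ℓ ε x' := by
  have hℓ := P.smooth.pos
  have hr := A.r_lower
  have hρ0 : 0 ≤ ρ := (norm_nonneg _).trans hx
  have hresx : c⁻¹ * ‖x - x'‖ + ℓ * ‖y' - y‖ + r * ‖x' - z‖ ≤ ε / 4 := by
    linarith [mul_le_mul_of_nonneg_left hx (inv_pos.2 A.c_pos).le,
      mul_le_mul_of_nonneg_left hy hℓ.le, mul_le_mul_of_nonneg_left hz (by linarith : 0 ≤ r),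
      mul_le_mul_of_nonneg_right A.primal_le hρ0]
  have hαK : α⁻¹ + ℓ ≤ K * ℓ := by linarith [A.dual_le]
  have hresy : (α⁻¹ + ℓ) * ‖y' - y‖ ≤ ε / 4 :=
    (mul_le_mul hαK hy (norm_nonneg _) (by linarith [inv_pos.2 A.α_pos])).trans hρ
  have hgap := h.valueFn_le P A.α_pos h.step_x.1
  rw [sub_self, norm_zero, mul_zero, add_zero] at hgap
  obtain ⟨v, hv, hvle⟩ :=
    h.exists_mem_normalCone_x_norm_gradX_add_le P (by linarith) A.c_pos A.c_upper
  obtain ⟨w, hw, hwle⟩ := h.exists_mem_normalCone_y P A.α_pos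
  refine ⟨isGS_of_mem_normalCone h.step_x.1 h.step_y.1 hv hw (by linarith) (by linarith),
    P.isOS_of_mem_normalCone hε h.step_x.1 h.step_y.1 hv (hvle.trans hresx) ?_⟩
  linarith [mul_le_mul_of_nonneg_right hαK
    (mul_nonneg (Metric.diam_nonneg (s := Y)) (norm_nonneg (y' - y)))]

theorem isGS_and_isOS_of_potential_lt (h : IsGDAStep f X Y r c α β x y z x' y' z')
    (P : IsNCCProblem f X Y ℓ) (A : AdmissibleStepSizes K ℓ r c α β) {ε ρ : ℝ} (hε : 0 < ε)
    (hρ : K * ℓ * ρ = ε / 4) (hnoise : 36 * K ^ 2 * β * Metric.diam Y ^ 2 ≤ ρ ^ 2)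
    (hlt : potential f X Y r x y z < potential f X Y r x' y' z' + ℓ * β * ρ ^ 2 / 4) :
    IsGS f X Y ε x' y' ∧ IsOS f X Y ℓ ε x' := by
  have hℓ := P.smooth.pos
  have hβ := A.β_pos
  have hK : 0 < K := one_pos.trans_le (A.one_le hℓ)
  have hρ0 : 0 < ρ := pos_of_mul_pos_right (by linarith : 0 < K * ℓ * ρ) (by positivity)
  have hsum : ℓ / 2 * ‖x - x'‖ ^ 2 + ℓ / 2 * ‖y' - y‖ ^ 2 + ℓ * β * ‖x' - z‖ ^ 2
      ≤ ℓ / 2 * (β * ρ ^ 2) := by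
    linarith [h.potential_add_le P A,
      mul_le_mul_of_nonneg_left hnoise (by positivity : 0 ≤ ℓ * β)]
  have hxterm : 0 ≤ ℓ / 2 * ‖x - x'‖ ^ 2 := by positivity
  have hyterm : 0 ≤ ℓ / 2 * ‖y' - y‖ ^ 2 := by positivity
  have hzterm : 0 ≤ ℓ * β * ‖x' - z‖ ^ 2 := by positivity
  have hβρ : β * ρ ^ 2 ≤ ρ ^ 2 :=
    mul_le_of_le_one_left (sq_nonneg ρ) (by linarith [A.β_upper])
  have hxsq : ‖x - x'‖ ^ 2 ≤ β * ρ ^ 2 :=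
    le_of_mul_le_mul_left (by linarith) (half_pos hℓ)
  have hysq : ‖y' - y‖ ^ 2 ≤ β * ρ ^ 2 :=
    le_of_mul_le_mul_left (by linarith) (half_pos hℓ)
  have hzsq : ‖x' - z‖ ^ 2 ≤ ρ ^ 2 :=
    le_of_mul_le_mul_left (by linarith [mul_pos (mul_pos hℓ hβ) (pow_pos hρ0 2)])
      (mul_pos hℓ hβ)
  have hdiam : 6 * K * (Metric.diam Y * ‖y' - y‖) ≤ ρ ^ 2 := by
    refine le_of_sq_le_sq ?_ (sq_nonneg ρ)
    calc (6 * K * (Metric.diam Y * ‖y' - y‖)) ^ 2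
        = 36 * K ^ 2 * Metric.diam Y ^ 2 * ‖y' - y‖ ^ 2 := by ring
      _ ≤ 36 * K ^ 2 * Metric.diam Y ^ 2 * (β * ρ ^ 2) := by gcongr
      _ = 36 * K ^ 2 * β * Metric.diam Y ^ 2 * ρ ^ 2 := by ring
      _ ≤ ρ ^ 2 * ρ ^ 2 := mul_le_mul_of_nonneg_right hnoise (sq_nonneg ρ)
      _ = (ρ ^ 2) ^ 2 := by ring
  refine h.isGS_and_isOS_of_norm_le P A hε hρ.le (le_of_sq_le_sq (hxsq.trans hβρ) hρ0.le)
    (le_of_sq_le_sq (hysq.trans hβρ) hρ0.le) (le_of_sq_le_sq hzsq hρ0.le) ?_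
  have hℓρ : ℓ * ρ ≤ ε / 4 := by
    linarith [mul_le_mul_of_nonneg_right (A.one_le hℓ) (mul_pos hℓ hρ0).le]
  rw [le_div_iff₀ (by positivity)]
  linarith [mul_le_mul_of_nonneg_left hdiam (sq_nonneg ℓ),
    pow_le_pow_left₀ (mul_pos hℓ hρ0).le hℓρ 2, sq_nonneg ε]

end IsGDAStep

theorem IsSmoothedGDA.exists_isGS_and_isOS {K r c α β ε ρ : ℝ} {x : ℕ → E n} {y : ℕ → E d}
    {z : ℕ → E n} (hG : IsSmoothedGDA f X Y r c α β x y z) (P : IsNCCProblem f X Y ℓ)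
    (hbdd : BddBelow (valueFn f Y '' X)) (A : AdmissibleStepSizes K ℓ r c α β) (hε : 0 < ε)
    (hρ : K * ℓ * ρ = ε / 4) (hnoise : 36 * K ^ 2 * β * Metric.diam Y ^ 2 ≤ ρ ^ 2) :
    ∃ t : ℕ, (t : ℝ) ≤ initialGap f X Y r (x 0) (y 0) (z 0) / (ℓ * β * ρ ^ 2 / 4) ∧
      IsGS f X Y ε (x (t + 1)) (y (t + 1)) ∧ IsOS f X Y ℓ ε (x (t + 1)) := by
  have hℓ := P.smooth.pos
  have hβ := A.β_pos
  have hrℓ : ℓ < r := by linarith [A.r_lower]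
  have hρ0 : ρ ≠ 0 := by
    rintro rfl
    linarith
  have hstep := fun t => hG.isGDAStep P.smooth t
  refine exists_le_div_of_forall_add_le (a := fun t => potential f X Y r (x t) (y t) (z t))
    (by positivity) (fun t => P.sInf_valueFn_le_potential hbdd hrℓ (hstep t).mem_x
      (hstep t).mem_y (z t)) fun t hnot => ?_
  contrapose! hnot
  exact (hstep t).isGS_and_isOS_of_potential_lt P A hε hρ hnoise hnot

end MinimaxNCC

open MinimaxNCC in
theorem mainTheorem7_general (K : ℝ) (hK : 0 < K) :
    ∃ b₀ : ℝ, 0 < b₀ ∧ ∀ b₁ : ℝ, 0 < b₁ → ∃ C : ℝ, 0 < C ∧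
    ∀ (n d : ℕ) (f : E n → E d → ℝ) (X : Set (E n)) (Y : Set (E d)) (ℓ ε r c α β : ℝ)
      (x : ℕ → E n) (y : ℕ → E d) (z : ℕ → E n),
      IsNCCProblem f X Y ℓ → 0 < Metric.diam Y → BddBelow (valueFn f Y '' X) → 0 < ε →
      AdmissibleStepSizes K ℓ r c α β →
      b₁ * (ε ^ 2 / (ℓ ^ 2 * Metric.diam Y ^ 2)) ≤ β →
      β ≤ b₀ * (ε ^ 2 / (ℓ ^ 2 * Metric.diam Y ^ 2)) →
      IsSmoothedGDA f X Y r c α β x y z →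
      ∃ t : ℕ,
        (t : ℝ) ≤ C * (ℓ ^ 3 * Metric.diam Y ^ 2 *
          initialGap f X Y r (x 0) (y 0) (z 0) / ε ^ 4) ∧
        IsGS f X Y ε (x (t + 1)) (y (t + 1)) ∧ IsOS f X Y ℓ ε (x (t + 1)) := by
  refine ⟨1 / (576 * K ^ 4), by positivity, fun b₁ hb₁ => ⟨64 * K ^ 2 / b₁, by positivity, ?_⟩⟩
  intro n d f X Y ℓ ε r c α β x y z P hD hbdd hε A hβ₁ hβ₀ hG
  have hℓ := P.smooth.pos
  have hrℓ : ℓ < r := by linarith [A.r_lower]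
  have hΔ : 0 ≤ initialGap f X Y r (x 0) (y 0) (z 0) :=
    sub_nonneg.2 (P.sInf_valueFn_le_potential hbdd hrℓ hG.init_x hG.init_y (z 0))
  have hnoise : 36 * K ^ 2 * β * Metric.diam Y ^ 2 ≤ (ε / (4 * K * ℓ)) ^ 2 :=
    calc 36 * K ^ 2 * β * Metric.diam Y ^ 2
        ≤ 36 * K ^ 2 * (1 / (576 * K ^ 4) * (ε ^ 2 / (ℓ ^ 2 * Metric.diam Y ^ 2)))
          * Metric.diam Y ^ 2 := by gcongr
      _ = (ε / (4 * K * ℓ)) ^ 2 := by field_simp; norm_num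
  obtain ⟨t, ht, hstationary⟩ :=
    hG.exists_isGS_and_isOS P hbdd A hε (ρ := ε / (4 * K * ℓ)) (by field_simp) hnoise
  refine ⟨t, ht.trans ?_, hstationary⟩
  calc initialGap f X Y r (x 0) (y 0) (z 0) / (ℓ * β * (ε / (4 * K * ℓ)) ^ 2 / 4)
      ≤ initialGap f X Y r (x 0) (y 0) (z 0) / (ℓ * (b₁ * (ε ^ 2 / (ℓ ^ 2 * Metric.diam Y ^ 2)))
          * (ε / (4 * K * ℓ)) ^ 2 / 4) := by gcongr
    _ = 64 * K ^ 2 / b₁ * (ℓ ^ 3 * Metric.diam Y ^ 2 *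
          initialGap f X Y r (x 0) (y 0) (z 0) / ε ^ 4) := by field_simp; norm_num

theorem mainTheorem7 :
    -- constants hidden in `r = Θ(ℓ)`, `c = Θ(1/ℓ)`, `α = Θ(1/ℓ)`
    ∀ κ γ a : ℝ, 0 < κ → 0 < γ → 0 < a →
    -- constants `b₁ ≤ b₀` hidden in `β = Θ(ε² / (ℓ² D²))`, and `C` of the iteration bound
    ∃ b₀ : ℝ, 0 < b₀ ∧ ∀ b₁ : ℝ, 0 < b₁ → ∃ C : ℝ, 0 < C ∧
    ∀ (n d : ℕ) (f : MinimaxNCC.E n → MinimaxNCC.E d → ℝ)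
      (X : Set (MinimaxNCC.E n)) (Y : Set (MinimaxNCC.E d)) (ℓ ε r c α β : ℝ)
      (x : ℕ → MinimaxNCC.E n) (y : ℕ → MinimaxNCC.E d) (z : ℕ → MinimaxNCC.E n),
      IsClosed X → Convex ℝ X →
      IsCompact Y → Convex ℝ Y → 0 < Metric.diam Y →
      MinimaxNCC.IsSmoothOn f X Y ℓ →
      (∀ u ∈ X, ConcaveOn ℝ Y (f u)) →
      BddBelow (MinimaxNCC.valueFn f Y '' X) →
      0 < ε →
      MinimaxNCC.StepSizes κ γ a ℓ r c α β →
      b₁ * (ε ^ 2 / (ℓ ^ 2 * Metric.diam Y ^ 2)) ≤ β →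
      β ≤ b₀ * (ε ^ 2 / (ℓ ^ 2 * Metric.diam Y ^ 2)) →
      MinimaxNCC.IsSmoothedGDA f X Y r c α β x y z →
      ∃ t : ℕ,
        (t : ℝ) ≤ C * (ℓ ^ 3 * Metric.diam Y ^ 2 *
          MinimaxNCC.initialGap f X Y r (x 0) (y 0) (z 0) / ε ^ 4) ∧
        MinimaxNCC.IsGS f X Y ε (x (t + 1)) (y (t + 1)) ∧
        MinimaxNCC.IsOS f X Y ℓ ε (x (t + 1)) := by
  intro κ γ a hκ hγ ha
  obtain ⟨b₀, hb₀, hgen⟩ := mainTheorem7_general (κ + 2 + 1 / γ + 1 / a) (by positivity)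
  refine ⟨b₀, hb₀, fun b₁ hb₁ => (hgen b₁ hb₁).imp fun C hC => ⟨hC.1, ?_⟩⟩
  intro n d f X Y ℓ ε r c α β x y z hXc hX hYc _ hD hf hconc hbdd hε hs hβ₁ hβ₀ hG
  exact hC.2 n d f X Y ℓ ε r c α β x y z ⟨hXc, hX, hYc, ⟨y 0, hG.init_y⟩, hf, hconc⟩ hD hbdd hε
    (hs.admissible hf.pos hγ ha) hβ₁ hβ₀ hG
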